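/- Let $k\ge 1$ and let $S_1,\dots,S_k$ be $0$-dimensional simplicial complexes (of any cardinality). Let $X=S_1*\cdots*S_k$ be their simplicial join, with the weak topology on its geometric realization, and let $\Delta$ be a $(k-1)$-simplex of $X$ (it is then maximal, and has vertices $s_i\in S_i$ for $1\le i\le k$). Let $Y$ be $X$ with the interior of $\Delta$ removed. Then $X$ is $(k-2)$-connected, and if the inclusion $\partial\Delta\to Y$ is nullhomotopic, then $Y$ is $(k-2)$-connected. Here a space $Z$ is $n$-connected ($n\ge -1$) if it is nonempty and $\pi_i(Z,z)$ is trivial for all $0\le i\le n$ and all $z\in Z$. A map $A\to Z$ is nullhomotopic if it is homotopic to a constant map with value some point of $Z$; in particular, for $k=1$, where $\partial\Delta=\emptyset$, the hypothesis says that $Y\neq\emptyset$. -/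

import Mathlib

open scoped Topology

noncomputable section

namespace AbstractSimplicialComplex

/-- A simplicial complex is `0`-dimensional if each of its simplices is a single vertex. -/
def IsZeroDimensional {V : Type*} (K : AbstractSimplicialComplex V) : Prop :=
  ∀ σ ∈ K.faces, σ.card = 1

/-- The part of a finite set of vertices of a disjoint union that lies in the `i`-th summand. -/
def slice {ι : Type*} {V : ι → Type*} (σ : Finset (Σ i, V i)) (i : ι) : Finset (V i) :=
  σ.preimage (Sigma.mk i) sigma_mk_injective.injOn

/-- The simplicial join of a family of simplicial complexes: its vertices form the disjoint union
of the vertex sets, and a nonempty finite set of vertices is a simplex if its part in each summand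
is empty or a simplex there. -/
def join {ι : Type*} {V : ι → Type*} (K : ∀ i, AbstractSimplicialComplex (V i)) :
    AbstractSimplicialComplex (Σ i, V i) where
  faces := {σ | σ.Nonempty ∧ ∀ i, slice σ i = ∅ ∨ slice σ i ∈ (K i).faces}
  isRelLowerSet_faces := by
    rintro σ ⟨hσ, h⟩
    refine ⟨hσ, fun τ hτσ hτ => ⟨hτ, fun i => ?_⟩⟩
    have hsub : slice τ i ⊆ slice σ i := fun v hv => by
      simp only [slice, Finset.mem_preimage] at hv ⊢
      exact hτσ hv
    rcases Finset.eq_empty_or_nonempty (slice τ i) with h0 | h0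
    · exact Or.inl h0
    · rcases h i with h1 | h1
      · rw [h1, Finset.subset_empty] at hsub
        exact Or.inl hsub
      · exact Or.inr (((K i).isRelLowerSet_faces h1).2 hsub h0)
  singleton_mem := by
    rintro ⟨j, v⟩
    refine ⟨Finset.singleton_nonempty _, fun i => ?_⟩
    by_cases hij : i = j
    · subst hij
      right
      have : slice ({⟨i, v⟩} : Finset (Σ i, V i)) i = {v} := by
        ext w
        simp [slice]
      rw [this]
      exact (K i).singleton_mem v
    · left
      ext w
      simp [slice, hij]

/-- The geometric realization `|K|`: finitely supported families of barycentric coordinates, i.e.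
nonnegative functions on the vertices with sum `1` whose support is a simplex of `K`. -/
def Realization {V : Type*} (K : AbstractSimplicialComplex V) : Type _ :=
  {x : V →₀ ℝ // (∀ v, 0 ≤ x v) ∧ (x.sum fun _ a => a) = 1 ∧ x.support ∈ K.faces}

namespace Realization

variable {V : Type*} (K : AbstractSimplicialComplex V)

/-- The closed simplex of `|K|` spanned by `σ`. -/
def closedSimplex (σ : Finset V) : Set K.Realization := {x | x.1.support ⊆ σ}

/-- The open simplex of `|K|` spanned by `σ`, that is, the interior of the simplex `σ`. -/
def openSimplex (σ : Finset V) : Set K.Realization := {x | x.1.support = σ}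

/-- The boundary of the simplex of `|K|` spanned by `σ`. -/
def simplexBoundary (σ : Finset V) : Set K.Realization := closedSimplex K σ \ openSimplex K σ

/-- The Euclidean topology of a closed simplex: the one given by the barycentric coordinates. -/
@[reducible] def simplexTopology (σ : Finset V) : TopologicalSpace (closedSimplex K σ) :=
  TopologicalSpace.induced (fun x (v : V) => (x.1.1 v : ℝ)) Pi.topologicalSpace

/-- The weak topology of `|K|`: a set is open if and only if its intersection with each closed
simplex is open in the Euclidean topology of that simplex. -/
instance instTopologicalSpace : TopologicalSpace K.Realization :=
  ⨆ σ : K.faces, TopologicalSpace.coinduced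
    (Subtype.val : closedSimplex K σ.1 → K.Realization) (simplexTopology K σ.1)

/-- `|K|` with the interior of the simplex `σ` removed. -/
def removeSimplex (σ : Finset V) : Set K.Realization := (openSimplex K σ)ᶜ

theorem simplexBoundary_subset_removeSimplex (σ : Finset V) :
    simplexBoundary K σ ⊆ removeSimplex K σ := fun _ hx => hx.2

/-- The inclusion of the boundary of `σ` into `|K|` with the interior of `σ` removed; both carry
the subspace topology. -/
def boundaryInclusion (σ : Finset V) : C(simplexBoundary K σ, removeSimplex K σ) :=
  ContinuousMap.inclusion (simplexBoundary_subset_removeSimplex K σ)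

end Realization

end AbstractSimplicialComplex

/-- A space is `n`-connected if it is nonempty (when `n ≥ -1`) and `π_i` is trivial for all
`0 ≤ i ≤ n` and all base points. There is no condition for `n ≤ -2`. -/
def IsNConnected (n : ℤ) (X : Type*) [TopologicalSpace X] : Prop :=
  (-1 ≤ n → Nonempty X) ∧ ∀ i : ℕ, (i : ℤ) ≤ n → ∀ x : X, Subsingleton (π_ i X x)

end

/-!
A point of the join `X` of `k` discrete sets is given by `k` nonnegative numbers with sum `1` and,
for each positive number, a vertex of the corresponding factor. So a map from a compact space `D`
to `X` amounts to `k` open sets covering `D`, a locally constant labelling of the `i`-th of them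
by finitely many vertices of the `i`-th factor, and a partition of unity. On a cube `D` of
dimension less than `k` there are many such covers: take `k` cubical grids of the same small mesh,
translated along the diagonal by different fractions of the mesh, and let the `i`-th open set be
the complement of the walls of the `i`-th grid. By the pigeonhole principle every point avoids the
walls of at least one grid (`exists_gridBump_ne_zero`), and each of the small open cells may be
labelled at will. If a map to `X` is given near the boundary of `D`, the labels can be chosen to
agree with those of the given map wherever the latter has a coordinate that is not small; then the
two families of coordinates can be blended. Hence every map from the boundary of `D` to `X` that
extends to a collar extends to `D` (`Realization.exists_extension`). Applied to the boundary of `I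
× I^n` with `n + 1 < k`, where a generalized loop is given at the bottom and the base point
elsewhere, this shows that the homotopy groups vanish
(`Realization.subsingleton_homotopyGroup_join`).

If the boundary of the simplex `Δ` is nullhomotopic in the complement `Y` of its interior, then
the inclusion of the boundary in `Y` extends over `Δ`. Since `Δ` is maximal, this gives a
retraction of `X` to `Y` (`Realization.exists_retraction_of_nullhomotopic`), and a retract of an
`n`-connected space is `n`-connected.
-/

/-! ### The weak topology of a realization -/

namespace AbstractSimplicialComplex

namespace Realization

section Topology

variable {V : Type*} {K : AbstractSimplicialComplex V}

theorem continuous_val_closedSimplex {σ : Finset V} (hσ : σ ∈ K.faces) :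
    @Continuous _ _ (simplexTopology K σ) _ (Subtype.val : closedSimplex K σ → K.Realization) :=
  continuous_iff_coinduced_le.2 (le_iSup (fun σ : K.faces => TopologicalSpace.coinduced
    (Subtype.val : closedSimplex K σ.1 → K.Realization) (simplexTopology K σ.1)) ⟨σ, hσ⟩)

theorem continuous_of_continuousOn_closedSimplex {Z : Type*} [TopologicalSpace Z]
    {f : K.Realization → Z} (h : ∀ σ ∈ K.faces, ContinuousOn f (closedSimplex K σ)) :
    Continuous f := by
  refine continuous_iSup_dom.2 fun σ => continuous_coinduced_dom.2 ?_
  have h1 := continuousOn_iff_continuous_domRestrict.1 (h σ.1 σ.2)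
  have h2 : @Continuous _ _ (simplexTopology K σ.1) instTopologicalSpaceSubtype
      (id : closedSimplex K σ.1 → closedSimplex K σ.1) :=
    continuous_induced_rng.2 (continuous_val_closedSimplex σ.2)
  exact @Continuous.comp _ _ _ (simplexTopology K σ.1) instTopologicalSpaceSubtype _ id
    (Set.domRestrict (closedSimplex K σ.1) f) h1 h2

/-- A linear functional of the barycentric coordinates is continuous for the weak topology,
however fast its coefficients grow. -/
theorem continuous_linearFunctional (a : V → ℝ) :
    Continuous fun x : K.Realization => x.1.sum fun v t => a v * t := by
  refine continuous_iSup_dom.2 fun σ => continuous_coinduced_dom.2 ?_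
  let _ := simplexTopology K σ.1
  have h : ((fun x : K.Realization => x.1.sum fun v t => a v * t) ∘
      (Subtype.val : closedSimplex K σ.1 → K.Realization)) =
      (fun y : V → ℝ => ∑ v ∈ σ.1, a v * y v) ∘ fun x (v : V) => (x.1.1 v : ℝ) := by
    funext x
    exact Finsupp.sum_of_support_subset _ x.2 _ (by simp)
  rw [h]
  exact Continuous.comp (by fun_prop) continuous_induced_dom

theorem continuous_coord (v : V) : Continuous fun x : K.Realization => x.1 v := by
  classical
  convert continuous_linearFunctional (K := K) (Pi.single v 1) with x
  rw [Finsupp.sum, Finset.sum_eq_single v]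
  · simp
  · intro b _ hb
    simp [Pi.single_eq_of_ne hb]
  · intro hv
    simpa using hv

/-- A compact set meets the open stars of only finitely many vertices: otherwise a linear
functional with suitable coefficients would be unbounded on it. -/
theorem finite_vertices_of_isCompact {C : Set K.Realization} (hC : IsCompact C) :
    {v | ∃ x ∈ C, x.1 v ≠ 0}.Finite := by
  by_contra hinf
  have hinf : {v | ∃ x ∈ C, x.1 v ≠ 0}.Infinite := hinf
  let e := hinf.natEmbedding
  have hx : ∀ n, ∃ x ∈ C, x.1 (e n : V) ≠ 0 := fun n => (e n).2
  choose x hxC hx using hx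
  let a : V → ℝ := Function.extend (fun n => (e n : V)) (fun n => n / (x n).1 (e n)) 0
  have hinj : Function.Injective fun n => (e n : V) := Subtype.val_injective.comp e.injective
  have ha : ∀ n, a (e n) = n / (x n).1 (e n) := fun n => hinj.extend_apply _ _ n
  have ha0 : ∀ v, 0 ≤ a v := by
    intro v
    by_cases hv : ∃ n, (e n : V) = v
    · obtain ⟨n, rfl⟩ := hv
      rw [ha]
      exact div_nonneg n.cast_nonneg ((x n).2.1 _)
    · simp only [a, Function.extend_apply' _ _ _ hv, Pi.zero_apply, le_refl]
  obtain ⟨M, hM⟩ := (hC.image (continuous_linearFunctional a)).bddAbove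
  obtain ⟨n, hn⟩ := exists_nat_gt M
  have h1 := hM ⟨x n, hxC n, rfl⟩
  have h2 : a (e n) * (x n).1 (e n) ≤ (x n).1.sum fun v t => a v * t :=
    Finset.single_le_sum (f := fun v => a v * (x n).1 v)
      (fun v _ => mul_nonneg (ha0 v) ((x n).2.1 v)) (Finsupp.mem_support_iff.2 (hx n))
  rw [ha, div_mul_cancel₀ _ (hx n)] at h2
  exact absurd (h2.trans h1) (not_le.2 hn)

/-- A map into a finite subcomplex is continuous if its barycentric coordinates are. -/
theorem continuous_of_continuous_coord {Z : Type*} [TopologicalSpace Z] {g : Z → K.Realization}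
    (T : Finset V) (hT : ∀ z, (g z).1.support ⊆ T) (hg : ∀ v, Continuous fun z => (g z).1 v) :
    Continuous g := by
  let F : {σ : Finset V // σ ∈ K.faces ∧ σ ⊆ T} → Set Z := fun σ => {z | (g z).1.support ⊆ σ.1}
  have : Finite {σ : Finset V // σ ∈ K.faces ∧ σ ⊆ T} :=
    Finite.of_injective (fun σ => (⟨σ.1, Finset.mem_powerset.2 σ.2.2⟩ : T.powerset))
      fun σ τ h => Subtype.ext (congrArg (fun x : T.powerset => x.1) h)
  have hF : ∀ σ, F σ = ⋂ v ∈ {v | v ∉ σ.1}, {z | (g z).1 v = 0} := by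
    intro σ
    ext z
    simp only [F, Set.mem_ofPred_eq, Set.mem_iInter, Finset.subset_iff, Finsupp.mem_support_iff]
    exact forall_congr' fun v => not_imp_comm
  refine (locallyFinite_of_finite F).continuous ?_ ?_ ?_
  · exact Set.eq_univ_of_forall fun z =>
      Set.mem_iUnion.2 ⟨⟨(g z).1.support, (g z).2.2.2, hT z⟩, Finset.Subset.refl _⟩
  · intro σ
    rw [hF]
    exact isClosed_biInter fun v _ => isClosed_eq (hg v) continuous_const
  · intro σ
    rw [continuousOn_iff_continuous_domRestrict]
    let _ := simplexTopology K σ.1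
    let g' : F σ → closedSimplex K σ.1 := fun z => ⟨g z.1, z.2⟩
    have hg' : Continuous g' := continuous_induced_rng.2
      (continuous_pi fun v => (hg v).comp continuous_subtype_val)
    exact (continuous_val_closedSimplex σ.2.1).comp hg'

/-- The point of the realization with barycentric coordinates proportional to `w`. -/
noncomputable def ofWeights (w : V →₀ ℝ) (h0 : ∀ v, 0 ≤ w v) (hw : w.support ∈ K.faces) :
    K.Realization :=
  ⟨(w.sum fun _ a => a)⁻¹ • w, by
    have hpos : 0 < w.sum fun _ a => a :=
      Finset.sum_pos (fun v hv => (h0 v).lt_of_ne' (Finsupp.mem_support_iff.1 hv))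
        (K.isRelLowerSet_faces hw).1
    refine ⟨fun v => mul_nonneg (inv_nonneg.2 hpos.le) (h0 v), ?_, ?_⟩
    · rw [Finsupp.sum_smul_index fun _ => rfl, ← Finsupp.mul_sum]
      exact inv_mul_cancel₀ hpos.ne'
    · rwa [Finsupp.support_smul_eq (inv_ne_zero hpos.ne')]⟩

theorem ofWeights_apply (w : V →₀ ℝ) (h0 : ∀ v, 0 ≤ w v) (hw : w.support ∈ K.faces) (v : V) :
    (ofWeights w h0 hw).1 v = (w.sum fun _ a => a)⁻¹ * w v := rfl

theorem support_ofWeights (w : V →₀ ℝ) (h0 : ∀ v, 0 ≤ w v) (hw : w.support ∈ K.faces) :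
    (ofWeights w h0 hw).1.support = w.support := by
  have hpos : 0 < w.sum fun _ a => a :=
    Finset.sum_pos (fun v hv => (h0 v).lt_of_ne' (Finsupp.mem_support_iff.1 hv))
      (K.isRelLowerSet_faces hw).1
  exact Finsupp.support_smul_eq (inv_ne_zero hpos.ne')

theorem ofWeights_eq (x : K.Realization) (w : V →₀ ℝ) (h0 : ∀ v, 0 ≤ w v)
    (hw : w.support ∈ K.faces) (h : w = x.1) : ofWeights w h0 hw = x := by
  subst h
  refine Subtype.ext (Finsupp.ext fun v => ?_)
  rw [ofWeights_apply, x.2.2.1, inv_one, one_mul]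

theorem continuous_ofWeights {Z : Type*} [TopologicalSpace Z] {w : Z → V →₀ ℝ}
    (h0 : ∀ z v, 0 ≤ w z v) (hw : ∀ z, (w z).support ∈ K.faces) (T : Finset V)
    (hT : ∀ z, (w z).support ⊆ T) (hc : ∀ v, Continuous fun z => w z v) :
    Continuous fun z => ofWeights (w z) (h0 z) (hw z) := by
  refine continuous_of_continuous_coord T (fun z => (support_ofWeights _ _ _).trans_subset (hT z))
    fun v => ?_
  have hs : ∀ z, (w z).sum (fun _ a => a) = ∑ v ∈ T, w z v := fun z =>
    Finsupp.sum_of_support_subset _ (hT z) _ (by simp)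
  have hpos : ∀ z, ∑ v ∈ T, w z v ≠ 0 := fun z => by
    rw [← hs z]
    exact (Finset.sum_pos (fun v hv => (h0 z v).lt_of_ne' (Finsupp.mem_support_iff.1 hv))
      (K.isRelLowerSet_faces (hw z)).1).ne'
  simp only [ofWeights_apply, hs]
  exact ((continuous_finsetSum T fun v _ => hc v).inv₀ hpos).mul (hc v)

end Topology

end Realization

end AbstractSimplicialComplex

/-! ### Joins of discrete sets, and translated grids in a cube -/

namespace AbstractSimplicialComplex

theorem mem_faces_join_iff {ι : Type*} {V : ι → Type*} {S : ∀ i, AbstractSimplicialComplex (V i)}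
    (hS : ∀ i, (S i).IsZeroDimensional) {σ : Finset (Σ i, V i)} :
    σ ∈ (join S).faces ↔ σ.Nonempty ∧ ∀ i (v v' : V i), ⟨i, v⟩ ∈ σ → ⟨i, v'⟩ ∈ σ → v = v' := by
  have hmem : ∀ i (v : V i), v ∈ slice σ i ↔ (⟨i, v⟩ : Σ i, V i) ∈ σ := fun i v =>
    Finset.mem_preimage
  refine and_congr_right fun _ => forall_congr' fun i => ⟨fun h v v' hv hv' => ?_, fun h => ?_⟩
  · rw [← hmem] at hv hv'
    rcases h with h | h
    · simp [h] at hv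
    · exact Finset.card_le_one.1 (hS i _ h).le v hv v' hv'
  · rcases (slice σ i).eq_empty_or_nonempty with h0 | ⟨v, hv⟩
    · exact Or.inl h0
    · right
      have : slice σ i = {v} := Finset.eq_singleton_iff_unique_mem.2
        ⟨hv, fun v' hv' => h v' v ((hmem i v').1 hv') ((hmem i v).1 hv)⟩
      rw [this]
      exact (S i).singleton_mem v

theorem injOn_fst_of_mem_faces_join {ι : Type*} {V : ι → Type*}
    {S : ∀ i, AbstractSimplicialComplex (V i)} (hS : ∀ i, (S i).IsZeroDimensional)
    {σ : Finset (Σ i, V i)} (hσ : σ ∈ (join S).faces) :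
    Set.InjOn Sigma.fst (σ : Set (Σ i, V i)) := by
  rintro ⟨i, v⟩ hv ⟨j, v'⟩ hv' (rfl : i = j)
  rw [((mem_faces_join_iff hS).1 hσ).2 i v v' hv hv']

theorem card_le_of_mem_faces_join {k : ℕ} {V : Fin k → Type*}
    {S : ∀ i, AbstractSimplicialComplex (V i)} (hS : ∀ i, (S i).IsZeroDimensional)
    {σ : Finset (Σ i, V i)} (hσ : σ ∈ (join S).faces) : σ.card ≤ k := by
  simpa using Finset.card_le_card_of_injOn Sigma.fst (fun _ _ => Finset.mem_univ _)
    (injOn_fst_of_mem_faces_join hS hσ)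

section Grid

open scoped unitInterval

variable {J : Type*} (N k : ℕ) (i : Fin k)

/-- The coordinates of a point of the cube with respect to the `i`-th of `k` cubical grids of mesh
`1 / N`; the `i`-th grid is the standard one translated by `i / k` times the mesh along the
diagonal. -/
noncomputable def gridCoord (z : J → I) (j : J) : ℝ := N * (z j : ℝ) - (i : ℝ) / k

/-- The cell of the `i`-th grid that contains a given point. -/
noncomputable def gridCell (z : J → I) (j : J) : ℤ := ⌊gridCoord N k i z j⌋

/-- A continuous function that vanishes exactly on the walls of the `i`-th grid. -/
noncomputable def gridBump [Fintype J] (z : J → I) : ℝ :=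
  ∏ j, |Real.sin (Real.pi * gridCoord N k i z j)|

theorem continuous_gridCoord (j : J) : Continuous fun z : J → I => gridCoord N k i z j := by
  unfold gridCoord
  fun_prop

theorem gridBump_nonneg [Fintype J] (z : J → I) : 0 ≤ gridBump N k i z :=
  Finset.prod_nonneg fun _ _ => abs_nonneg _

theorem continuous_gridBump [Fintype J] : Continuous (gridBump N k i : (J → I) → ℝ) := by
  unfold gridBump
  exact continuous_finsetProd _ fun j _ =>
    (Real.continuous_sin.comp (continuous_const.mul (continuous_gridCoord N k i j))).abs

theorem gridBump_eq_zero_iff [Fintype J] {z : J → I} :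
    gridBump N k i z = 0 ↔ ∃ j, ∃ n : ℤ, (n : ℝ) = gridCoord N k i z j := by
  simp only [gridBump, Finset.prod_eq_zero_iff, abs_eq_zero, Real.sin_eq_zero_iff,
    Finset.mem_univ, true_and]
  refine exists_congr fun j => exists_congr fun n => ?_
  rw [mul_comm, mul_right_inj' Real.pi_ne_zero]

/-- In dimension less than `k`, no point lies on a wall of every one of the `k` grids: otherwise,
by the pigeonhole principle, two of the grids would have a common wall orthogonal to some axis. -/
theorem exists_gridBump_ne_zero [Fintype J] (hJ : Fintype.card J < k) (z : J → I) :
    ∃ i, gridBump N k i z ≠ 0 := by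
  by_contra! h
  simp only [gridBump_eq_zero_iff] at h
  choose j n hn using h
  have hk : (0 : ℝ) < k := by exact_mod_cast (Nat.zero_le _).trans_lt hJ
  have hinj : Function.Injective j := by
    intro a b hab
    have ha := hn a
    have hb := hn b
    rw [hab] at ha
    unfold gridCoord at ha hb
    have h1 : (k : ℝ) * (n b - n a : ℤ) = (a : ℝ) - b := by
      push_cast
      rw [ha, hb]
      field_simp
      ring
    have h2 : (k : ℤ) * (n b - n a) = (a : ℤ) - b := by exact_mod_cast h1
    have h3 : |(a : ℤ) - b| < k := by
      have := a.2
      have := b.2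
      rw [abs_lt]
      omega
    have h4 := Int.eq_zero_of_abs_lt_dvd ⟨_, h2.symm⟩ h3
    ext
    omega
  have := Fintype.card_le_of_injective j hinj
  rw [Fintype.card_fin] at this
  omega

theorem eventually_gridCell_eq [Fintype J] {z : J → I} (hz : gridBump N k i z ≠ 0) :
    ∀ᶠ z' in 𝓝 z, gridCell N k i z' = gridCell N k i z := by
  have hne := (not_congr (gridBump_eq_zero_iff N k i)).1 hz
  push Not at hne
  have : ∀ j, ∀ᶠ z' in 𝓝 z, gridCell N k i z' j = gridCell N k i z j := by
    intro j
    have h1 : gridCoord N k i z j ∈ Set.Ioo (gridCell N k i z j : ℝ) (gridCell N k i z j + 1) :=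
      ⟨(Int.floor_le _).lt_of_ne (hne j _), Int.lt_floor_add_one _⟩
    filter_upwards [(continuous_gridCoord N k i j).continuousAt.eventually
      (isOpen_Ioo.mem_nhds h1)] with z' hz'
    exact Int.floor_eq_iff.2 ⟨hz'.1.le, hz'.2⟩
  filter_upwards [Filter.eventually_all.2 this] with z' hz'
  exact funext hz'

open Classical in
theorem continuous_ite_gridCell [Fintype J] (P : (J → ℤ) → Prop) :
    Continuous fun z : J → I => if P (gridCell N k i z) then gridBump N k i z else 0 := by
  rw [continuous_iff_continuousAt]
  intro z
  have hb := (continuous_gridBump (J := J) N k i).continuousAt (x := z)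
  by_cases hz : gridBump N k i z = 0
  · have h0 : (if P (gridCell N k i z) then gridBump N k i z else 0) = 0 := by simp [hz]
    rw [ContinuousAt, h0]
    rw [ContinuousAt, hz] at hb
    refine squeeze_zero (fun z' => ?_) (fun z' => ?_) hb
    · split_ifs
      exacts [gridBump_nonneg N k i z', le_rfl]
    · split_ifs
      exacts [le_rfl, gridBump_nonneg N k i z']
  · have hev := eventually_gridCell_eq N k i hz
    by_cases hP : P (gridCell N k i z)
    · refine hb.congr ?_
      filter_upwards [hev] with z' hz'
      rw [hz', if_pos hP]
    · refine (continuousAt_const (y := (0 : ℝ))).congr ?_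
      filter_upwards [hev] with z' hz'
      rw [hz', if_neg hP]

theorem dist_le_of_gridCell_eq [Fintype J] (hN : 0 < N) {z z' : J → I}
    (h : gridCell N k i z = gridCell N k i z') : dist z z' ≤ 1 / N := by
  have hN' : (0 : ℝ) < N := by exact_mod_cast hN
  refine (dist_pi_le_iff (by positivity)).2 fun j => ?_
  have h1 := Int.abs_sub_lt_one_of_floor_eq_floor (congrFun h j)
  unfold gridCoord at h1
  rw [sub_sub_sub_cancel_right, ← mul_sub, abs_mul, abs_of_pos hN'] at h1
  rw [Subtype.dist_eq, Real.dist_eq, le_div_iff₀ hN', mul_comm]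
  exact h1.le

end Grid

end AbstractSimplicialComplex

/-! ### Extension of maps from a cube to a join -/

namespace AbstractSimplicialComplex

namespace Realization

section Extension

open scoped unitInterval

variable {k : ℕ} {V : Fin k → Type*} {S : ∀ i, AbstractSimplicialComplex (V i)}

theorem coord_le_one {W : Type*} {K : AbstractSimplicialComplex W} (x : K.Realization) (v : W) :
    x.1 v ≤ 1 := by
  by_cases hv : v ∈ x.1.support
  · refine le_of_le_of_eq ?_ x.2.2.1
    exact Finset.single_le_sum (f := fun v => x.1 v) (fun v _ => x.2.1 v) hv
  · rw [Finsupp.notMem_support_iff.1 hv]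
    exact zero_le_one

theorem exists_inv_le_coord (hS : ∀ i, (S i).IsZeroDimensional) (x : (join S).Realization) :
    ∃ p, (k : ℝ)⁻¹ ≤ x.1 p := by
  by_contra! h
  have hne : x.1.support.Nonempty := ((join S).isRelLowerSet_faces x.2.2.2).1
  have hcard : (x.1.support.card : ℝ) ≤ k := by
    exact_mod_cast card_le_of_mem_faces_join hS x.2.2.2
  have hk : (0 : ℝ) < k := lt_of_lt_of_le (by exact_mod_cast hne.card_pos) hcard
  have h1 : (x.1.sum fun _ a => a) < ∑ _p ∈ x.1.support, (k : ℝ)⁻¹ :=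
    Finset.sum_lt_sum_of_nonempty hne fun p _ => h p
  rw [x.2.2.1, Finset.sum_const, nsmul_eq_mul, ← div_eq_mul_inv, lt_div_iff₀ hk] at h1
  linarith

theorem coord_unique (hS : ∀ i, (S i).IsZeroDimensional) (x : (join S).Realization) {i : Fin k}
    {v v' : V i} (hv : 0 < x.1 ⟨i, v⟩) (hv' : 0 < x.1 ⟨i, v'⟩) : v = v' :=
  ((mem_faces_join_iff hS).1 x.2.2.2).2 i v v' (Finsupp.mem_support_iff.2 hv.ne')
    (Finsupp.mem_support_iff.2 hv'.ne')

/-- Uniform continuity of all barycentric coordinates at once, which holds because only finitely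
many of them do not vanish identically on the given compact set. -/
theorem exists_mesh {J : Type*} [Fintype J] {W : Type*} {K : AbstractSimplicialComplex W}
    {A : Set (J → I)} (hA : IsClosed A) {f : (J → I) → K.Realization} (hf : ContinuousOn f A)
    {ε : ℝ} (hε : 0 < ε) :
    ∃ N : ℕ, 0 < N ∧ ∀ z ∈ A, ∀ z' ∈ A, dist z z' ≤ 1 / N →
      ∀ v, |(f z).1 v - (f z').1 v| < ε := by
  have hfin := finite_vertices_of_isCompact (hA.isCompact.image_of_continuousOn hf)
  have := hfin.fintype
  let g : (J → I) → ({v | ∃ x ∈ f '' A, x.1 v ≠ 0} → ℝ) := fun z v => (f z).1 v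
  have hg : ContinuousOn g A :=
    continuousOn_pi.2 fun v => (continuous_coord v.1).comp_continuousOn hf
  obtain ⟨δ, hδ, h⟩ := Metric.uniformContinuousOn_iff.1
    (hA.isCompact.uniformContinuousOn_of_continuous hg) ε hε
  obtain ⟨n, hn⟩ := exists_nat_one_div_lt hδ
  refine ⟨n + 1, n.succ_pos, fun z hz z' hz' hd v => ?_⟩
  by_cases hv : ∃ x ∈ f '' A, x.1 v ≠ 0
  · rw [← Real.dist_eq]
    refine (dist_le_pi_dist (g z) (g z') ⟨v, hv⟩).trans_lt (h z hz z' hz' (hd.trans_lt ?_))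
    exact_mod_cast hn
  · push Not at hv
    rw [hv _ ⟨z, hz, rfl⟩, hv _ ⟨z', hz', rfl⟩, sub_zero, abs_zero]
    exact hε

/-- A map `f` from a closed subset `A` of a cube of dimension less than `k` to the join of `k`
discrete sets agrees with a map defined on the whole cube at the points of `A` where `c` vanishes,
if `c ≥ 1` off `A`. The coordinates of `f` are truncated at height `c`; as soon as `c` exceeds
`1 / (2 k)`, the bump functions of `k` translated fine grids are added, those of the `i`-th grid as
coordinates in the `i`-th factor. On each cell of the `i`-th grid the vertex of the `i`-th factor
is chosen to be the one in which `f` has a coordinate greater than `1 / (2 k)` somewhere on the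
cell, if there is any; uniform continuity makes this choice consistent. -/
theorem exists_extension (hS : ∀ i, (S i).IsZeroDimensional) (hV : ∀ i, Nonempty (V i))
    {J : Type*} [Fintype J] (hJ : Fintype.card J < k) {A : Set (J → I)} (hA : IsClosed A)
    {f : (J → I) → (join S).Realization} (hf : ContinuousOn f A) {c : (J → I) → ℝ}
    (hc : Continuous c) (hc0 : ∀ z, 0 ≤ c z) (hcA : ∀ z ∉ A, 1 ≤ c z) :
    ∃ F : C(J → I, (join S).Realization), ∀ z ∈ A, c z = 0 → F z = f z := by
  classical
  have hk : (0 : ℝ) < k := by exact_mod_cast (Nat.zero_le _).trans_lt hJ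
  let ε : ℝ := (k : ℝ)⁻¹ / 2
  have hε : 0 < ε := by positivity
  have hε1 : ε < (k : ℝ)⁻¹ := half_lt_self (by positivity)
  have hεone : ε < 1 :=
    hε1.trans_le (inv_le_one_of_one_le₀ (by exact_mod_cast (Nat.zero_le _).trans_lt hJ))
  obtain ⟨N, hN, hmesh⟩ := exists_mesh hA hf hε
  have hfin := finite_vertices_of_isCompact (hA.isCompact.image_of_continuousOn hf)
  let base : ∀ i, V i := fun i => (hV i).some
  let T : Finset (Σ i, V i) := hfin.toFinset ∪ Finset.univ.image fun i => ⟨i, base i⟩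
  have hTf : ∀ z ∈ A, ∀ p, (f z).1 p ≠ 0 → p ∈ T := fun z hz p hp =>
    Finset.mem_union_left _ (hfin.mem_toFinset.2 ⟨_, ⟨z, hz, rfl⟩, hp⟩)
  have hlabel : ∀ (i : Fin k) (q : J → ℤ), ∃ v : V i, (⟨i, v⟩ : Σ i, V i) ∈ T ∧
      ∀ z ∈ A, ∀ v' : V i, ε < (f z).1 ⟨i, v'⟩ → gridCell N k i z = q → v' = v := by
    intro i q
    by_cases hex : ∃ z ∈ A, ∃ v : V i, ε < (f z).1 ⟨i, v⟩ ∧ gridCell N k i z = q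
    · obtain ⟨z, hz, v, hv, rfl⟩ := hex
      refine ⟨v, hTf z hz _ (hε.trans hv).ne', fun z' hz' v' hv' hcell => ?_⟩
      have h1 := hmesh z hz z' hz' (dist_le_of_gridCell_eq N k i hN hcell.symm) ⟨i, v⟩
      exact coord_unique hS (f z') (hε.trans hv') (by linarith [(abs_lt.1 h1).2])
    · push Not at hex
      exact ⟨base i, Finset.mem_union_right _ (Finset.mem_image_of_mem _ (Finset.mem_univ i)),
        fun z hz v' hv' hcell => absurd hcell (hex z hz v' hv')⟩
  choose label hlabelT hlabel using hlabel
  -- The truncated coordinates of `f`, the coordinates given by the grids, and the weight of the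
  -- latter.
  let a : (Σ i, V i) → (J → I) → ℝ := fun p z => if z ∈ A then max ((f z).1 p - c z) 0 else 0
  let b : (Σ i, V i) → (J → I) → ℝ := fun p z =>
    if label p.1 (gridCell N k p.1 z) = p.2 then gridBump N k p.1 z else 0
  let ν : (J → I) → ℝ := fun z => max (c z - ε) 0
  have ha0 : ∀ p z, 0 ≤ a p z := fun p z => by
    simp only [a]
    split_ifs
    exacts [le_max_right _ _, le_rfl]
  have hb0 : ∀ p z, 0 ≤ b p z := fun p z => by
    simp only [b]
    split_ifs
    exacts [gridBump_nonneg _ _ _ _, le_rfl]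
  have hν0 : ∀ z, 0 ≤ ν z := fun z => le_max_right _ _
  have hac : ∀ p, Continuous (a p) := by
    intro p
    have hcl : IsClosed {z | 1 ≤ c z} := isClosed_le continuous_const hc
    have hcover : A ∪ {z | 1 ≤ c z} = Set.univ := Set.eq_univ_of_forall fun z =>
      (em (z ∈ A)).imp id (hcA z)
    rw [← continuousOn_univ, ← hcover]
    refine ContinuousOn.union_of_isClosed ?_ ?_ hA hcl
    · refine ContinuousOn.congr (f := fun z => max ((f z).1 p - c z) 0) ?_
        fun z hz => if_pos hz
      have hsub : ContinuousOn (fun z => (f z).1 p - c z) A :=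
        ((continuous_coord p).comp_continuousOn hf).sub hc.continuousOn
      exact hsub.sup continuousOn_const
    · refine (continuousOn_const (c := (0 : ℝ))).congr fun z (hz : 1 ≤ c z) => ?_
      simp only [a]
      split_ifs
      · exact max_eq_right (by linarith [coord_le_one (f z) p])
      · rfl
  have hbc : ∀ p, Continuous (b p) := fun p =>
    continuous_ite_gridCell N k p.1 fun q => label p.1 q = p.2
  have hνc : Continuous ν := (hc.sub continuous_const).max continuous_const
  have ha : ∀ p z, 0 < a p z → z ∈ A ∧ c z < (f z).1 p := by
    intro p z h
    simp only [a] at h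
    split_ifs at h with hz
    · exact ⟨hz, by simpa using h⟩
    · exact absurd h (lt_irrefl _)
  have hb : ∀ p z, 0 < b p z → label p.1 (gridCell N k p.1 z) = p.2 := by
    intro p z h
    by_contra hne
    simp only [b, if_neg hne, lt_irrefl] at h
  have hνε : ∀ z, 0 < ν z → ε < c z := fun z h => by simpa [ν] using h
  have hT : ∀ p z, a p z + ν z * b p z ≠ 0 → p ∈ T := by
    intro p z h
    rcases (ha0 p z).eq_or_lt' with h1 | h1
    · have h2 : b p z ≠ 0 := fun h2 => h (by rw [h1, h2, mul_zero, add_zero])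
      have h3 := hlabelT p.1 (gridCell N k p.1 z)
      rwa [hb p z ((hb0 p z).lt_of_ne' h2)] at h3
    · exact hTf z (ha p z h1).1 p ((hc0 z).trans_lt (ha p z h1).2).ne'
  let w : (J → I) → (Σ i, V i) →₀ ℝ := fun z =>
    Finsupp.onFinset T (fun p => a p z + ν z * b p z) fun p => hT p z
  have hw : ∀ z p, w z p = a p z + ν z * b p z := fun z p => rfl
  have hw0 : ∀ z p, 0 ≤ w z p := fun z p =>
    add_nonneg (ha0 p z) (mul_nonneg (hν0 z) (hb0 p z))
  have hpos : ∀ z p, w z p ≠ 0 → 0 < a p z ∨ 0 < ν z ∧ 0 < b p z := by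
    intro z p h
    by_contra! hn
    obtain ⟨hn1, hn2⟩ := hn
    have h1 : a p z = 0 := le_antisymm hn1 (ha0 p z)
    rcases (hν0 z).eq_or_lt' with h2 | h2
    · exact h (by rw [hw, h1, h2, zero_mul, add_zero])
    · exact h (by rw [hw, h1, le_antisymm (hn2 h2) (hb0 p z), mul_zero, add_zero])
  -- Where both kinds of coordinates are present, `c > ε`, so that a surviving coordinate of `f`
  -- exceeds `ε` and determines the label.
  have hmixed : ∀ z i (v v' : V i), 0 < a ⟨i, v⟩ z → 0 < ν z → 0 < b ⟨i, v'⟩ z → v = v' := by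
    intro z i v v' h1 h2 h3
    refine Eq.trans ?_ (hb _ _ h3)
    exact hlabel i _ z (ha _ _ h1).1 v ((hνε z h2).trans (ha _ _ h1).2) rfl
  have hface : ∀ z, (w z).support ∈ (join S).faces := by
    intro z
    refine (mem_faces_join_iff hS).2 ⟨?_, fun i v v' hv hv' => ?_⟩
    -- Some coordinate of `f z` is at least `1 / k`, and survives while `c z ≤ ε`; beyond that a
    -- grid coordinate is positive.
    · rcases le_or_gt (c z) ε with hcz | hcz
      · obtain ⟨p, hp⟩ := exists_inv_le_coord hS (f z)
        refine ⟨p, Finsupp.mem_support_iff.2 (ne_of_gt ?_)⟩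
        have hz : z ∈ A := by
          by_contra hz
          linarith [hcA z hz]
        refine add_pos_of_pos_of_nonneg ?_ (mul_nonneg (hν0 z) (hb0 p z))
        simp only [a, if_pos hz]
        exact lt_max_of_lt_left (by linarith)
      · obtain ⟨i, hi⟩ := exists_gridBump_ne_zero N k hJ z
        refine ⟨⟨i, label i (gridCell N k i z)⟩, Finsupp.mem_support_iff.2 (ne_of_gt ?_)⟩
        refine add_pos_of_nonneg_of_pos (ha0 _ z) (mul_pos ?_ ?_)
        · exact lt_max_of_lt_left (by linarith)
        · simpa [b] using (gridBump_nonneg N k i z).lt_of_ne' hi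
    · rcases hpos z _ (Finsupp.mem_support_iff.1 hv) with h1 | h1 <;>
        rcases hpos z _ (Finsupp.mem_support_iff.1 hv') with h2 | h2
      · exact coord_unique hS (f z) ((hc0 z).trans_lt (ha _ _ h1).2)
          ((hc0 z).trans_lt (ha _ _ h2).2)
      · exact hmixed z i v v' h1 h2.1 h2.2
      · exact (hmixed z i v' v h2 h1.1 h1.2).symm
      · exact (hb _ _ h1.2).symm.trans (hb _ _ h2.2)
  refine ⟨⟨fun z => ofWeights (w z) (hw0 z) (hface z), ?_⟩, fun z hz hcz => ?_⟩
  · exact continuous_ofWeights hw0 hface T (fun z => Finsupp.support_onFinset_subset)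
      fun p => (hac p).add (hνc.mul (hbc p))
  · refine ofWeights_eq _ _ (hw0 z) (hface z) (Finsupp.ext fun p => ?_)
    have h1 : ν z = 0 := max_eq_right (by linarith)
    have h2 : a p z = (f z).1 p := by
      simp only [a, if_pos hz, hcz, sub_zero]
      exact max_eq_left ((f z).2.1 p)
    rw [hw, h1, h2, zero_mul, add_zero]

end Extension

end Realization

end AbstractSimplicialComplex

/-! ### Vanishing of homotopy groups -/

namespace AbstractSimplicialComplex

namespace Realization

section HomotopyGroups

open scoped unitInterval

/-- The cube magnified from its centre by the factor `1 + 2 s`, where `s` is the zeroth coordinate,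
and clamped to the unit cube. -/
noncomputable def magnify {n : ℕ} (z : Fin (n + 1) → I) (i : Fin n) : I :=
  Set.projIcc 0 1 zero_le_one ((1 + 2 * (z 0 : ℝ)) * z i.succ - z 0)

theorem continuous_magnify {n : ℕ} : Continuous (magnify : (Fin (n + 1) → I) → Fin n → I) :=
  continuous_pi fun _ => continuous_projIcc.comp (by fun_prop)

theorem magnify_cons_zero {n : ℕ} (y : Fin n → I) : magnify (Fin.cons 0 y) = y := by
  funext i
  simp [magnify]

/-- A point at magnification `1 + 2 s` lands on the face `0` or `1` once it is within
`s / (1 + 2 s)` of it. -/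
theorem magnify_mem_boundary {n : ℕ} {z : Fin (n + 1) → I}
    (h : ∃ i : Fin n, (1 + 2 * (z 0 : ℝ)) * z i.succ ≤ z 0 ∨
      1 + z 0 ≤ (1 + 2 * (z 0 : ℝ)) * z i.succ) : magnify z ∈ Cube.boundary (Fin n) := by
  obtain ⟨i, h | h⟩ := h
  · exact ⟨i, Or.inl (Set.projIcc_of_le_left _ (by linarith))⟩
  · exact ⟨i, Or.inr (Set.projIcc_of_right_le _ (by linarith))⟩

/-- A function that vanishes on the boundary of the cube and is at least `1` on the inner cube
`(1/4, 3/4)^m`. -/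
theorem exists_inner_outer_separation (m : ℕ) :
    ∃ c : (Fin m → I) → ℝ, Continuous c ∧ (∀ z, 0 ≤ c z) ∧
      (∀ z ∈ Cube.boundary (Fin m), c z = 0) ∧
      ∀ z, (¬ ∃ j, (z j : ℝ) ≤ 1 / 4 ∨ 3 / 4 ≤ (z j : ℝ)) → 1 ≤ c z := by
  have hB : IsClosed (Cube.boundary (Fin m)) := by
    have : Cube.boundary (Fin m) = ⋃ j, {z : Fin m → I | z j = 0 ∨ z j = 1} := by
      ext z
      simp [Cube.boundary]
    rw [this]
    exact isClosed_iUnion_of_finite fun j =>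
      (isClosed_eq (continuous_apply j) continuous_const).union
        (isClosed_eq (continuous_apply j) continuous_const)
  have hC : IsClosed {z : Fin m → I | ∀ j, (1 / 4 : ℝ) ≤ z j ∧ (z j : ℝ) ≤ 3 / 4} := by
    have : {z : Fin m → I | ∀ j, (1 / 4 : ℝ) ≤ z j ∧ (z j : ℝ) ≤ 3 / 4} =
        ⋂ j, ({z : Fin m → I | (1 / 4 : ℝ) ≤ z j} ∩ {z : Fin m → I | (z j : ℝ) ≤ 3 / 4}) := by
      ext z
      simp
    rw [this]
    exact isClosed_iInter fun j =>
      (isClosed_le continuous_const (by fun_prop)).inter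
        (isClosed_le (by fun_prop) continuous_const)
  have hd : Disjoint (Cube.boundary (Fin m))
      {z : Fin m → I | ∀ j, (1 / 4 : ℝ) ≤ z j ∧ (z j : ℝ) ≤ 3 / 4} := by
    refine Set.disjoint_left.2 ?_
    rintro z ⟨j, hj | hj⟩ hz
    · have := (hz j).1
      rw [hj] at this
      norm_num at this
    · have := (hz j).2
      rw [hj] at this
      norm_num at this
  obtain ⟨c, h0, h1, h01⟩ := exists_continuous_zero_one_of_isClosed hB hC hd
  refine ⟨c, c.continuous, fun z => (h01 z).1, fun z hz => h0 hz, fun z hz => ?_⟩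
  push Not at hz
  exact (h1 fun j => ⟨(hz j).1.le, (hz j).2.le⟩).ge

theorem subsingleton_homotopyGroup_join {k : ℕ} {V : Fin k → Type*}
    {S : ∀ i, AbstractSimplicialComplex (V i)} (hS : ∀ i, (S i).IsZeroDimensional)
    (hV : ∀ i, Nonempty (V i)) {n : ℕ} (hn : n + 1 < k) (x : (join S).Realization) :
    Subsingleton (π_ n (join S).Realization x) := by
  suffices h : ∀ g : GenLoop (Fin n) (join S).Realization x, GenLoop.Homotopic g GenLoop.const by
    refine ⟨fun p q => ?_⟩
    induction p using Quotient.inductionOn with | _ p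
    induction q using Quotient.inductionOn with | _ q
    exact Quotient.sound ((h p).trans (h q).symm)
  intro g
  -- The zeroth coordinate of `I^(n + 1)` is the time of the homotopy.
  let A : Set (Fin (n + 1) → I) := {z | ∃ j, (z j : ℝ) ≤ 1 / 4 ∨ 3 / 4 ≤ (z j : ℝ)}
  have hA : IsClosed A := by
    have : A = ⋃ j, ({z : Fin (n + 1) → I | (z j : ℝ) ≤ 1 / 4} ∪
        {z : Fin (n + 1) → I | (3 / 4 : ℝ) ≤ z j}) := by
      ext z
      simp [A]
    rw [this]
    exact isClosed_iUnion_of_finite fun j =>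
      (isClosed_le (by fun_prop) continuous_const).union
        (isClosed_le continuous_const (by fun_prop))
  -- The boundary of `I × I^n` carries `g` at the bottom and `x` elsewhere; `f` extends this map to
  -- the collar `A`.
  let f : (Fin (n + 1) → I) → (join S).Realization := fun z =>
    if (z 0 : ℝ) ≤ 1 / 2 then g (magnify z) else x
  have hf : ContinuousOn f A := by
    have hL : IsClosed {z : Fin (n + 1) → I | (z 0 : ℝ) ≤ 1 / 2} :=
      isClosed_le (by fun_prop) continuous_const
    have hR : IsClosed {z : Fin (n + 1) → I | (1 / 2 : ℝ) ≤ z 0} :=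
      isClosed_le continuous_const (by fun_prop)
    have hLR : A = A ∩ {z | (z 0 : ℝ) ≤ 1 / 2} ∪ A ∩ {z | (1 / 2 : ℝ) ≤ z 0} := by
      rw [← Set.inter_union_distrib_left]
      exact (Set.inter_eq_left.2 fun z _ => le_total (z 0 : ℝ) (1 / 2)).symm
    rw [hLR]
    refine ContinuousOn.union_of_isClosed ?_ ?_ (hA.inter hL) (hA.inter hR)
    · exact (g.1.continuous.comp continuous_magnify).continuousOn.congr fun z hz => if_pos hz.2
    · refine (continuousOn_const (c := x)).congr ?_
      rintro z ⟨⟨j, hj⟩, hz⟩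
      -- At time `1 / 2` the two halves of `f` agree on `A`: there `magnify` doubles the cube, so
      -- that the points with a coordinate outside of `(1/4, 3/4)` go to the boundary.
      rcases (show (1 / 2 : ℝ) ≤ z 0 from hz).eq_or_lt with h | h
      · refine (if_pos h.ge).trans (g.2 _ (magnify_mem_boundary ?_))
        rw [← h]
        induction j using Fin.cases with
        | zero => rcases hj with hj | hj <;> linarith
        | succ i => exact ⟨i, hj.imp (fun hj => by linarith) fun hj => by linarith⟩
      · exact if_neg (not_le.2 h)
  obtain ⟨c, hc, hc0, hcB, hcA⟩ := exists_inner_outer_separation (n + 1)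
  obtain ⟨F, hF⟩ := exists_extension hS hV (by simpa using hn) hA hf hc hc0 hcA
  have hFB : ∀ z ∈ Cube.boundary (Fin (n + 1)), F z = f z := by
    intro z hz
    refine hF z ?_ (hcB z hz)
    obtain ⟨j, hj⟩ := hz
    refine ⟨j, hj.imp (fun h => ?_) fun h => ?_⟩ <;> rw [h] <;> norm_num
  have hside : ∀ (s : I), ∀ y ∈ Cube.boundary (Fin n), F (Fin.cons s y) = x := by
    intro s y hy
    obtain ⟨i, hi⟩ := hy
    rw [hFB _ ⟨i.succ, by simpa using hi⟩]
    simp only [f]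
    split_ifs
    · refine g.2 _ (magnify_mem_boundary ⟨i, ?_⟩)
      simp only [Fin.cons_zero, Fin.cons_succ]
      refine hi.imp (fun h => ?_) fun h => ?_
      · rw [h, Set.Icc.coe_zero, mul_zero]
        exact s.2.1
      · rw [h, Set.Icc.coe_one]
        linarith [s.2.1]
    · rfl
  refine ⟨{ toFun := fun p => F (Fin.cons p.1 p.2 : Fin (n + 1) → I)
            continuous_toFun := F.continuous.comp <|
              Continuous.finCons (A := fun _ => I) continuous_fst continuous_snd
            map_zero_left := fun y => ?_
            map_one_left := fun y => ?_
            prop' := fun s y hy => ?_ }⟩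
  · rw [hFB _ ⟨0, Or.inl rfl⟩]
    refine (if_pos (by simp)).trans ?_
    rw [magnify_cons_zero]
    rfl
  · rw [hFB _ ⟨0, Or.inr rfl⟩]
    exact if_neg (by norm_num)
  · exact (hside s y hy).trans (g.2 y hy).symm

end HomotopyGroups

end Realization

end AbstractSimplicialComplex

/-! ### Retraction to the complement of an open simplex -/

namespace AbstractSimplicialComplex

namespace Realization

section Retraction

variable {V : Type*} {K : AbstractSimplicialComplex V}

theorem isClosed_closedSimplex (σ : Finset V) : IsClosed (closedSimplex K σ) := by
  have : closedSimplex K σ = ⋂ v ∈ {v | v ∉ σ}, {x : K.Realization | x.1 v = 0} := by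
    ext x
    simp only [closedSimplex, Set.mem_ofPred_eq, Set.mem_iInter, Finset.subset_iff,
      Finsupp.mem_support_iff]
    exact forall_congr' fun v => not_imp_comm
  rw [this]
  exact isClosed_biInter fun v _ => isClosed_eq (continuous_coord v) continuous_const

/-- The smallest barycentric coordinate of a point with respect to the vertices of `σ`. -/
noncomputable def minCoord (σ : Finset V) (hσ : σ.Nonempty) (x : K.Realization) : ℝ :=
  σ.inf' hσ fun v => x.1 v

theorem continuous_minCoord (σ : Finset V) (hσ : σ.Nonempty) :
    Continuous (minCoord σ hσ : K.Realization → ℝ) :=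
  Continuous.finset_inf'_apply hσ fun v _ => continuous_coord v

theorem minCoord_le {σ : Finset V} (hσ : σ.Nonempty) (x : K.Realization) {v : V} (hv : v ∈ σ) :
    minCoord σ hσ x ≤ x.1 v := Finset.inf'_le _ hv

theorem minCoord_nonneg (σ : Finset V) (hσ : σ.Nonempty) (x : K.Realization) :
    0 ≤ minCoord σ hσ x := Finset.le_inf' _ _ fun v _ => x.2.1 v

theorem minCoord_eq_zero_of_mem_simplexBoundary {σ : Finset V} (hσ : σ.Nonempty)
    {x : K.Realization} (hx : x ∈ simplexBoundary K σ) : minCoord σ hσ x = 0 := by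
  obtain ⟨v, hv, hvx⟩ := Finset.exists_of_ssubset
    (Finset.ssubset_iff_subset_ne.2 ⟨hx.1, hx.2⟩)
  refine le_antisymm ?_ (minCoord_nonneg σ hσ x)
  exact (minCoord_le hσ x hv).trans_eq (Finsupp.notMem_support_iff.1 hvx)

theorem sum_coord_of_mem_closedSimplex {σ : Finset V} {x : K.Realization}
    (hx : x ∈ closedSimplex K σ) : ∑ v ∈ σ, x.1 v = 1 := by
  refine Eq.trans ?_ x.2.2.1
  exact (Finsupp.sum_of_support_subset x.1 hx (fun _ a => a) fun _ _ => rfl).symm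

/-- A continuous map defined on the boundary of a simplex and nullhomotopic in `Z` extends over the
simplex. Along the segment from the barycentre to a boundary point `y`, with the smallest
coordinate `m` going from `1 / card σ` to `0`, the extension is constant until `m` has decreased
to half its maximum, and then runs through the track of `y` in reverse. -/
theorem exists_extension_of_nullhomotopic {Z : Type*} [TopologicalSpace Z] {σ : Finset V}
    (hσ : σ ∈ K.faces) {φ : C(simplexBoundary K σ, Z)} (hφ : φ.Nullhomotopic) :
    ∃ e : K.Realization → Z, ContinuousOn e (closedSimplex K σ) ∧
      ∀ x : simplexBoundary K σ, e x = φ x := by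
  classical
  obtain ⟨z₀, ⟨H⟩⟩ := hφ
  have hne : σ.Nonempty := (K.isRelLowerSet_faces hσ).1
  have hcard : (0 : ℝ) < σ.card := by exact_mod_cast hne.card_pos
  let m : K.Realization → ℝ := minCoord σ hne
  have hm : Continuous m := continuous_minCoord σ hne
  have hm0 : ∀ x, 0 ≤ m x := minCoord_nonneg σ hne
  let A : Set K.Realization := closedSimplex K σ ∩ {x | 2 * σ.card * m x ≤ 1}
  let B : Set K.Realization := closedSimplex K σ ∩ {x | 1 ≤ 2 * σ.card * m x}
  have hA : IsClosed A := (isClosed_closedSimplex σ).inter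
    (isClosed_le (by fun_prop) continuous_const)
  have hB : IsClosed B := (isClosed_closedSimplex σ).inter
    (isClosed_le continuous_const (by fun_prop))
  -- On `A` the smallest coordinate is less than `1 / card σ`, so that subtracting it from all
  -- coordinates leaves a nonzero vector; this is the radial projection to the boundary.
  let w : A → V →₀ ℝ := fun x =>
    Finsupp.onFinset σ (fun v => if v ∈ σ then x.1.1 v - m x.1 else 0) fun v hv => by
      by_contra h
      exact hv (if_neg h)
  have hw : ∀ x v, w x v = if v ∈ σ then x.1.1 v - m x.1 else 0 := fun x v => rfl
  have hw0 : ∀ x v, 0 ≤ w x v := by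
    intro x v
    rw [hw]
    split_ifs with hv
    · exact sub_nonneg.2 (minCoord_le hne x.1 hv)
    · exact le_rfl
  have hwσ : ∀ x, (w x).support ⊆ σ := fun x => Finsupp.support_onFinset_subset
  have hwne : ∀ x, (w x).support.Nonempty := by
    intro x
    by_contra h
    rw [Finset.not_nonempty_iff_eq_empty, Finsupp.support_eq_empty] at h
    have h1 : ∑ v ∈ σ, (x.1.1 v - m x.1) = 0 := Finset.sum_eq_zero fun v hv => by
      have h2 := hw x v
      rwa [if_pos hv, h, Finsupp.zero_apply, eq_comm] at h2
    rw [Finset.sum_sub_distrib, sum_coord_of_mem_closedSimplex x.2.1, Finset.sum_const,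
      nsmul_eq_mul] at h1
    have h2 : 2 * σ.card * m x.1 ≤ 1 := x.2.2
    linarith
  have hwface : ∀ x, (w x).support ∈ K.faces := fun x =>
    (K.isRelLowerSet_faces hσ).2 (hwσ x) (hwne x)
  let P : A → simplexBoundary K σ := fun x => ⟨ofWeights (w x) (hw0 x) (hwface x), by
    refine ⟨(support_ofWeights _ _ _).trans_subset (hwσ x), fun (h : Finsupp.support _ = σ) => ?_⟩
    -- A vertex at which the smallest coordinate is attained has dropped out of the support.
    obtain ⟨v, hv, hvm⟩ := Finset.exists_mem_eq_inf' hne fun v => x.1.1 v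
    have h1 : v ∈ (w x).support := by
      rwa [← support_ofWeights (w x) (hw0 x) (hwface x), h]
    refine Finsupp.mem_support_iff.1 h1 ?_
    rw [hw, if_pos hv]
    exact sub_eq_zero.2 hvm.symm⟩
  have hP : Continuous P := by
    refine Continuous.subtype_mk (continuous_ofWeights hw0 hwface σ hwσ fun v => ?_) _
    by_cases hv : v ∈ σ
    · simp only [hw, if_pos hv]
      exact ((continuous_coord v).sub hm).comp continuous_subtype_val
    · simp only [hw, if_neg hv]
      exact continuous_const
  let t : A → unitInterval := fun x =>
    ⟨2 * σ.card * m x.1, mul_nonneg (by positivity) (hm0 _), x.2.2⟩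
  have ht : Continuous t :=
    Continuous.subtype_mk (by fun_prop) _
  let e : K.Realization → Z := fun x => if hx : x ∈ A then H (t ⟨x, hx⟩, P ⟨x, hx⟩) else z₀
  have heA : ∀ x : A, e x = H (t x, P x) := fun x => dif_pos x.2
  refine ⟨e, ?_, fun x => ?_⟩
  · have hAB : closedSimplex K σ = A ∪ B := by
      rw [← Set.inter_union_distrib_left]
      exact (Set.inter_eq_left.2 fun x _ => le_total (2 * σ.card * m x) 1).symm
    rw [hAB]
    refine ContinuousOn.union_of_isClosed ?_ ?_ hA hB
    · rw [continuousOn_iff_continuous_domRestrict]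
      exact (H.continuous.comp (ht.prodMk hP)).congr fun x => (heA x).symm
    · refine (continuousOn_const (c := z₀)).congr fun x hx => ?_
      by_cases hxA : x ∈ A
      · have ht1 : t ⟨x, hxA⟩ = 1 := Subtype.ext (le_antisymm hxA.2 hx.2)
        rw [heA ⟨x, hxA⟩, ht1]
        exact H.map_one_left _
      · exact dif_neg hxA
  · have hm1 : m x = 0 := minCoord_eq_zero_of_mem_simplexBoundary hne x.2
    have hxA : (x : K.Realization) ∈ A := by
      refine ⟨x.2.1, ?_⟩
      simp [hm1]
    have ht0 : t ⟨x, hxA⟩ = 0 := Subtype.ext (by simp [t, hm1])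
    have hPx : P ⟨x, hxA⟩ = x := by
      refine Subtype.ext (ofWeights_eq _ _ (hw0 ⟨x, hxA⟩) (hwface ⟨x, hxA⟩)
        (Finsupp.ext fun v => ?_))
      rw [hw]
      split_ifs with hv
      · simp [hm1]
      · exact (Finsupp.notMem_support_iff.1 fun h => hv (x.2.1 h)).symm
    rw [heA ⟨x, hxA⟩, ht0, hPx]
    exact H.map_zero_left x

/-- If the boundary of a maximal simplex is nullhomotopic in the complement of the open simplex,
then this complement is a retract. -/
theorem exists_retraction_of_nullhomotopic {σ : Finset V} (hσ : σ ∈ K.faces)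
    (hmax : ∀ τ ∈ K.faces, σ ⊆ τ → τ = σ) (h : (boundaryInclusion K σ).Nullhomotopic) :
    ∃ r : C(K.Realization, removeSimplex K σ), ∀ y : removeSimplex K σ, r y = y := by
  classical
  obtain ⟨e, he, heb⟩ := exists_extension_of_nullhomotopic hσ h
  let r : K.Realization → removeSimplex K σ := fun x =>
    if hx : x ∈ removeSimplex K σ then ⟨x, hx⟩ else e x
  have hr : ∀ y : removeSimplex K σ, r y = y := fun y => dif_pos y.2
  refine ⟨⟨r, continuous_of_continuousOn_closedSimplex fun τ hτ => ?_⟩, hr⟩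
  by_cases hστ : τ = σ
  · subst hστ
    refine he.congr fun x hx => ?_
    by_cases hxr : x ∈ removeSimplex K τ
    · exact (hr ⟨x, hxr⟩).trans (heb ⟨x, hx, hxr⟩).symm
    · exact dif_neg hxr
  · have hsub : closedSimplex K τ ⊆ removeSimplex K σ := by
      intro x hx (hxσ : x.1.support = σ)
      exact hστ (hmax τ hτ (hxσ ▸ hx))
    rw [continuousOn_iff_continuous_domRestrict]
    exact (continuous_inclusion hsub).congr fun x => (hr ⟨x.1, hsub x.2⟩).symm

end Retraction

end Realization

end AbstractSimplicialComplex

/-- A retract of an `n`-connected space is `n`-connected. -/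
theorem IsNConnected.of_retraction {X Y : Type*} [TopologicalSpace X] [TopologicalSpace Y] {n : ℤ}
    (hX : IsNConnected n X) (s : C(Y, X)) (r : C(X, Y)) (h : ∀ y, r (s y) = y) :
    IsNConnected n Y := by
  refine ⟨fun hn => (hX.1 hn).map r, fun i hi y => ?_⟩
  suffices hg : ∀ g : GenLoop (Fin i) Y y, GenLoop.Homotopic g GenLoop.const by
    refine ⟨fun p q => ?_⟩
    induction p using Quotient.inductionOn with | _ p
    induction q using Quotient.inductionOn with | _ q
    exact Quotient.sound ((hg p).trans (hg q).symm)
  intro g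
  have hsub := hX.2 i hi (s y)
  let g' : GenLoop (Fin i) X (s y) := ⟨s.comp g.1, fun z hz => congrArg s (g.2 z hz)⟩
  have h1 : GenLoop.Homotopic g' GenLoop.const := Quotient.exact (hsub.elim ⟦g'⟧ ⟦GenLoop.const⟧)
  have h2 := ContinuousMap.HomotopicRel.comp_continuousMap h1 r
  have h3 : r.comp g'.1 = g.1 := ContinuousMap.ext fun z => h _
  have h4 : r.comp (GenLoop.const : GenLoop (Fin i) X (s y)).1 =
      (GenLoop.const : GenLoop (Fin i) Y y).1 := ContinuousMap.ext fun z => h y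
  rwa [h3, h4] at h2

theorem mainTheorem8 (k : ℕ) (V : Fin k → Type*)
    (S : ∀ i, AbstractSimplicialComplex (V i)) (hS : ∀ i, (S i).IsZeroDimensional)
    (Δ : Finset (Σ i, V i)) (hΔ : Δ ∈ (AbstractSimplicialComplex.join S).faces)
    (hcard : Δ.card = k) :
    IsNConnected ((k : ℤ) - 2) (AbstractSimplicialComplex.join S).Realization ∧
      ((AbstractSimplicialComplex.Realization.boundaryInclusion
          (AbstractSimplicialComplex.join S) Δ).Nullhomotopic →
        IsNConnected ((k : ℤ) - 2)
          (AbstractSimplicialComplex.Realization.removeSimplex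
            (AbstractSimplicialComplex.join S) Δ)) := by
  open AbstractSimplicialComplex Realization in
  classical
  -- The simplex `Δ` has `k` vertices, hence one in each factor.
  have hV : ∀ i, Nonempty (V i) := by
    have himage : Δ.image Sigma.fst = Finset.univ := Finset.eq_univ_of_card _ <| by
      rw [Finset.card_image_of_injOn (injOn_fst_of_mem_faces_join hS hΔ), hcard, Fintype.card_fin]
    intro i
    obtain ⟨p, -, rfl⟩ := Finset.mem_image.1 (himage ▸ Finset.mem_univ i)
    exact ⟨p.2⟩
  have hX : IsNConnected ((k : ℤ) - 2) (join S).Realization :=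
    ⟨fun _ => ⟨ofWeights (Finsupp.indicator Δ fun _ _ => 1)
        (fun v => by rw [Finsupp.indicator_apply]; split_ifs <;> norm_num)
        (by
          convert hΔ
          ext v
          simp [Finsupp.indicator_apply])⟩,
      fun i hi x => subsingleton_homotopyGroup_join hS hV (by omega) x⟩
  refine ⟨hX, fun h => ?_⟩
  obtain ⟨r, hr⟩ := exists_retraction_of_nullhomotopic hΔ
    (fun τ hτ hsub => (Finset.eq_of_subset_of_card_le hsub
      ((card_le_of_mem_faces_join hS hτ).trans_eq hcard.symm)).symm) h
  exact hX.of_retraction ⟨Subtype.val, continuous_subtype_val⟩ r hr
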